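/- Let $n\geq 4$ be even, and let $B_n(\mathbb{S}^2)$ be the $n$-string braid group of the sphere, i.e. the group generated by $\sigma_1,\ldots,\sigma_{n-1}$ subject to the relations $\sigma_i\sigma_j=\sigma_j\sigma_i$ for $|i-j|\geq 2$, $\sigma_i\sigma_{i+1}\sigma_i=\sigma_{i+1}\sigma_i\sigma_{i+1}$ for $1\leq i\leq n-2$, and $\sigma_1\cdots\sigma_{n-2}\sigma_{n-1}^2\sigma_{n-2}\cdots\sigma_1=1$. Put $\alpha_0=\sigma_1\cdots\sigma_{n-1}$, $\alpha_2=\sigma_1\cdots\sigma_{n-3}\sigma_{n-2}^2$ and $\Delta=(\sigma_1\cdots\sigma_{n-1})(\sigma_1\cdots\sigma_{n-2})\cdots(\sigma_1\sigma_2)\sigma_1$. For $m\geq 1$ let $\mathrm{Dic}_{4m}=\langle a,b\mid a^{2m}=1,\ b^2=a^m,\ bab^{-1}=a^{-1}\rangle$ be the dicyclic group of order $4m$ (so that $\mathrm{Dic}_4\cong\mathbb{Z}_4$). Let $N\in\{n,n-2\}$, and let $x=\alpha_0$ if $N=n$, and $x=\alpha_0\alpha_2\alpha_0^{-1}$ if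 $N=n-2$. Write $N=2^lk$ with $l\geq 0$ and $k$ odd. Let $0\leq j\leq l$, let $q\geq 1$ be a divisor of $k$, and for $0\leq i\leq 2^j-1$ put $H_i=\langle x^{2^jq},\,x^{iq}\Delta\rangle\subset B_n(\mathbb{S}^2)$. Then: (a) $H_0,\ldots,H_{2^j-1}$ are $2^j$ pairwise distinct subgroups of $B_n(\mathbb{S}^2)$, each isomorphic to $\mathrm{Dic}_{2^{l+2-j}k/q}$. (b) For $0\leq i,i'\leq 2^j-1$, the subgroups $H_i$ and $H_{i'}$ are conjugate in $B_n(\mathbb{S}^2)$ if and only if $i-i'$ is even. This is detected by the Abelianisation: $H_i$ and $H_{i'}$ have the same image in the Abelianisation of $B_n(\mathbb{S}^2)$ if and only if $i-i'$ is even. -/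

import Mathlib

/-- The letter `σ_i` (`1 ≤ i ≤ n - 1`) of the free group on `n - 1` letters.  The letters are numbered
from `1`, as usual for braids; the value at any other index is the junk value `1`. -/
def sphereBraidLetter (n i : ℕ) : FreeGroup (Fin (n - 1)) :=
  if h : 1 ≤ i ∧ i ≤ n - 1 then FreeGroup.of ⟨i - 1, by omega⟩ else 1

/-- The relators of the `n`-string braid group of the sphere:
`σ_i σ_j = σ_j σ_i` for `|i - j| ≥ 2`, `σ_i σ_{i+1} σ_i = σ_{i+1} σ_i σ_{i+1}`, and
`σ_1 ⋯ σ_{n-2} σ_{n-1}² σ_{n-2} ⋯ σ_1 = 1`. -/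
def sphereBraidRels (n : ℕ) : Set (FreeGroup (Fin (n - 1))) :=
  let s := sphereBraidLetter n
  {r | ∃ i j : ℕ, 1 ≤ i ∧ i ≤ n - 1 ∧ 1 ≤ j ∧ j ≤ n - 1 ∧ (i + 2 ≤ j ∨ j + 2 ≤ i) ∧
      r = (s i * s j) * (s j * s i)⁻¹} ∪
  {r | ∃ i : ℕ, 1 ≤ i ∧ i + 2 ≤ n ∧
      r = (s i * s (i + 1) * s i) * (s (i + 1) * s i * s (i + 1))⁻¹} ∪
  {((List.range (n - 2)).map fun i => s (i + 1)).prod * s (n - 1) ^ 2 *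
      ((List.range (n - 2)).reverse.map fun i => s (i + 1)).prod}

/-- The braid group `B_n(S²)` of the sphere on `n` strings, by its standard presentation. -/
abbrev SphereBraidGroup (n : ℕ) : Type := PresentedGroup (sphereBraidRels n)

namespace SphereBraidGroup

/-- The standard generator `σ_i` of `B_n(S²)`, for `1 ≤ i ≤ n - 1`. -/
def sigma (n i : ℕ) : SphereBraidGroup n :=
  PresentedGroup.mk (sphereBraidRels n) (sphereBraidLetter n i)

/-- The product `σ_1 σ_2 ⋯ σ_m` in `B_n(S²)`. -/
def ascending (n m : ℕ) : SphereBraidGroup n :=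
  ((List.range m).map fun i => sigma n (i + 1)).prod

/-- `α_0 = σ_1 ⋯ σ_{n-2} σ_{n-1}`. -/
def alpha0 (n : ℕ) : SphereBraidGroup n := ascending n (n - 1)

/-- `α_2 = σ_1 ⋯ σ_{n-3} σ_{n-2}²`. -/
def alpha2 (n : ℕ) : SphereBraidGroup n := ascending n (n - 3) * sigma n (n - 2) ^ 2

/-- The Garside element (half twist)
`Δ = (σ_1 ⋯ σ_{n-1}) (σ_1 ⋯ σ_{n-2}) ⋯ (σ_1 σ_2) σ_1`. -/
def garside (n : ℕ) : SphereBraidGroup n :=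
  ((List.range (n - 1)).map fun i => ascending n (n - 1 - i)).prod

/-- The subgroup `⟨x^{2^j q}, x^{i q} Δ⟩` of `B_n(S²)`. -/
def dicyclicSubgroup {n : ℕ} (x : SphereBraidGroup n) (j q i : ℕ) :
    Subgroup (SphereBraidGroup n) :=
  Subgroup.closure {x ^ (2 ^ j * q), x ^ (i * q) * garside n}

end SphereBraidGroup

/-- Two subgroups of a group are conjugate. -/
def AreConjSubgroups {G : Type*} [Group G] (H K : Subgroup G) : Prop :=
  ∃ g : G, H.map (MulAut.conj g).toMonoidHom = K

/-!
Write `Δ` for the half twist and let `x` be `α₀` or `α₀ α₂ α₀⁻¹`.  The claims follow from three facts: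
`Δ x Δ⁻¹ = x⁻¹`, `x ^ N = Δ ^ 2`, and `x` has order exactly `2 * N`.  They say that `x` and `Δ`
generate a dicyclic group of order `4 * N`, in which isomorphism types and equality of the subgroups
`⟨x ^ d, x ^ e Δ⟩` can be read off.

The first two facts come from the braid relations.  Conjugation by `σ_1 ⋯ σ_m` shifts the generators,
conjugation by `Δ` reverses their order, and collecting letters with the shift shows that
`σ_1 ⋯ σ_m` and `σ_1 ⋯ σ_{m-1} σ_m ^ 2` are roots of full twists
(`IsBraidSeq.ascProd_pow`, `IsBraidSeq.ascProd_mul_sq_pow`).  On the sphere, the full twist on all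
strands equals the full twist on all but one of them, which gives `α₂ ^ (n - 2) = Δ ^ 2`.

For the order of `x`, its image in the symmetric group is a cycle of length `N`, and
`Δ ^ 4 = 1` because `Δ` both inverts and fixes `x ^ N`.  The remaining point is `Δ ^ 2 ≠ 1`
(`SphereBraidGroup.garside_sq_ne_one`), which is the nontriviality of `π₁(SO(3))` and is invisible in
the symmetric group and in the Abelianisation.  It is detected by forgetting all but three strands,
which sends the pure braid group of the sphere to a group of order two.  Induced to all braids, this
becomes an action on labellings of the strands together with a counter modulo `4`, in which
`σ_i` interchanges two labels and adds to the counter a multiple of their product (`spinPerm`).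

For conjugacy, `x ^ t` conjugates `x ^ e Δ` to `x ^ (e + 2 * t) Δ`, so only the parity of `i` can
matter.  The exponent sum modulo `2 * (n - 1)` maps `x` to the element `n - 1` of order two, and hence
sees this parity.
-/

/-! ### Consequences of the braid relations -/

section BraidSequences

variable {G : Type*} [Group G]

/-- The product `s 0 * s 1 * ⋯ * s (k - 1)`. -/
def ascProd (s : ℕ → G) (k : ℕ) : G := ((List.range k).map s).prod

/-- The product `s (k - 1) * ⋯ * s 1 * s 0`. -/
def descProd (s : ℕ → G) (k : ℕ) : G := ((List.range k).reverse.map s).prod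

/-- The half twist on the first `m + 1` strands, where `s i` is the crossing of the strands `i` and
`i + 1`. -/
def halfTwist (s : ℕ → G) : ℕ → G
  | 0 => 1
  | m + 1 => ascProd s (m + 1) * halfTwist s m

/-- The first `m` terms of `s` satisfy Artin's relations of the braid group on `m + 1` strands. -/
structure IsBraidSeq (m : ℕ) (s : ℕ → G) : Prop where
  comm : ∀ i j, i + 2 ≤ j → j < m → s i * s j = s j * s i
  braid : ∀ i, i + 1 < m → s i * s (i + 1) * s i = s (i + 1) * s i * s (i + 1)

@[simp] lemma ascProd_zero (s : ℕ → G) : ascProd s 0 = 1 := by simp [ascProd]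

@[simp] lemma descProd_zero (s : ℕ → G) : descProd s 0 = 1 := by simp [descProd]

lemma ascProd_succ (s : ℕ → G) (k : ℕ) : ascProd s (k + 1) = ascProd s k * s k := by
  simp [ascProd, List.range_succ]

lemma descProd_succ (s : ℕ → G) (k : ℕ) : descProd s (k + 1) = s k * descProd s k := by
  simp [descProd, List.range_succ]

lemma ascProd_succ_eq_zero_mul (s : ℕ → G) (k : ℕ) :
    ascProd s (k + 1) = s 0 * ascProd (fun i => s (i + 1)) k := by
  simp [ascProd, List.range_succ_eq_map, Function.comp_def]

lemma map_ascProd {H : Type*} [Group H] (φ : G →* H) (s : ℕ → G) (k : ℕ) :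
    φ (ascProd s k) = ascProd (fun i => φ (s i)) k := by
  simp [ascProd, map_list_prod, Function.comp_def]

lemma map_descProd {H : Type*} [Group H] (φ : G →* H) (s : ℕ → G) (k : ℕ) :
    φ (descProd s k) = descProd (fun i => φ (s i)) k := by
  simp [descProd, map_list_prod, List.map_reverse, Function.comp_def]

lemma ascProd_congr {s t : ℕ → G} {k : ℕ} (h : ∀ i < k, s i = t i) :
    ascProd s k = ascProd t k := by
  simp only [ascProd]
  congr 1
  exact List.map_congr_left fun i hi => h i (List.mem_range.1 hi)

lemma descProd_congr {s t : ℕ → G} {k : ℕ} (h : ∀ i < k, s i = t i) :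
    descProd s k = descProd t k := by
  simp only [descProd]
  congr 1
  exact List.map_congr_left fun i hi => h i (by simpa using hi)

lemma SemiconjBy.ascProd {r : G} {s t : ℕ → G} {k : ℕ}
    (h : ∀ i < k, SemiconjBy r (s i) (t i)) :
    SemiconjBy r (_root_.ascProd s k) (_root_.ascProd t k) := by
  induction k with
  | zero => simp
  | succ k ih =>
    rw [ascProd_succ, ascProd_succ]
    exact (ih fun i hi => h i (by omega)).mul_right (h k (by omega))

lemma SemiconjBy.descProd {r : G} {s t : ℕ → G} {k : ℕ}
    (h : ∀ i < k, SemiconjBy r (s i) (t i)) :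
    SemiconjBy r (_root_.descProd s k) (_root_.descProd t k) := by
  induction k with
  | zero => simp
  | succ k ih =>
    rw [descProd_succ, descProd_succ]
    exact (h k (by omega)).mul_right (ih fun i hi => h i (by omega))

lemma ascProd_reflect (s : ℕ → G) (m : ℕ) :
    ascProd (fun i => s (m - 1 - i)) m = descProd s m := by
  induction m with
  | zero => simp
  | succ m ih =>
    rw [ascProd_succ_eq_zero_mul, descProd_succ, ← ih]
    simp only [Nat.add_sub_cancel, Nat.sub_zero]
    congr 2
    ext i
    congr 1
    omega

lemma halfTwist_eq_prod (s : ℕ → G) (m : ℕ) :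
    halfTwist s m = ((List.range m).map fun i => ascProd s (m - i)).prod := by
  induction m with
  | zero => simp [halfTwist]
  | succ m ih => simp [halfTwist, ih, List.range_succ_eq_map, Function.comp_def]

lemma commute_halfTwist {r : G} {s : ℕ → G} {m : ℕ} (h : ∀ i < m, Commute r (s i)) :
    Commute r (halfTwist s m) := by
  induction m with
  | zero => simp [halfTwist]
  | succ m ih =>
    exact Commute.mul_right (SemiconjBy.ascProd h) (ih fun i hi => h i (by omega))

namespace IsBraidSeq

variable {M : ℕ} {s : ℕ → G}

/-- Conjugation by `s 0 * ⋯ * s (m - 1)` shifts the generators. -/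
lemma semiconjBy_ascProd (hs : IsBraidSeq M s) {m : ℕ} (hm : m ≤ M) {i : ℕ} (hi : i + 1 < m) :
    SemiconjBy (ascProd s m) (s i) (s (i + 1)) := by
  induction m with
  | zero => omega
  | succ m ih =>
    rcases Nat.lt_or_ge (i + 1) m with h | h
    · have hc : SemiconjBy (s m) (s i) (s i) := (hs.comm i m h (by omega)).symm
      rw [ascProd_succ]
      exact (ih (by omega) h).mul_left hc
    · obtain rfl : m = i + 1 := by omega
      have hc : Commute (s (i + 1)) (ascProd s i) :=
        SemiconjBy.ascProd fun t ht => (hs.comm t (i + 1) (by omega) (by omega)).symm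
      rw [ascProd_succ, ascProd_succ]
      calc ascProd s i * s i * s (i + 1) * s i
          = ascProd s i * (s i * s (i + 1) * s i) := by group
        _ = ascProd s i * s (i + 1) * s i * s (i + 1) := by
          rw [hs.braid i (by omega)]; group
        _ = s (i + 1) * (ascProd s i * s i * s (i + 1)) := by
          rw [← hc.eq]; group

lemma zero_mul_ascProd_mul_ascProd (hs : IsBraidSeq M s) {m : ℕ} (hm : m ≤ M) {k : ℕ}
    (hk : k < m) : s 0 * ascProd s m * ascProd s k = ascProd s (k + 1) * ascProd s m := by
  have h : SemiconjBy (ascProd s m) (ascProd s k) (ascProd (fun i => s (i + 1)) k) :=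
    SemiconjBy.ascProd fun i hi => hs.semiconjBy_ascProd hm (by omega)
  rw [mul_assoc, h.eq, ascProd_succ_eq_zero_mul, mul_assoc]

/-- Conjugation by the half twist reverses the order of the generators. -/
lemma semiconjBy_halfTwist (hs : IsBraidSeq M s) {m : ℕ} (hm : m ≤ M) {i : ℕ} (hi : i < m) :
    SemiconjBy (halfTwist s m) (s i) (s (m - 1 - i)) := by
  induction m with
  | zero => omega
  | succ m ih =>
    rcases Nat.lt_or_ge i m with h | h
    · have h1 := hs.semiconjBy_ascProd hm (i := m - 1 - i) (by omega)
      rw [show m - 1 - i + 1 = m + 1 - 1 - i by omega] at h1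
      exact h1.mul_left (ih (by omega) h)
    · obtain rfl : m = i := by omega
      rw [show m + 1 - 1 - m = 0 by omega]
      rcases m with _ | m
      · simp [halfTwist, ascProd_succ, SemiconjBy]
      · -- The last generator commutes with all but the two longest factors of the half twist.
        have hc : Commute (s (m + 1)) (halfTwist s m) :=
          commute_halfTwist fun t ht => (hs.comm t (m + 1) (by omega) (by omega)).symm
        have h2 := hs.zero_mul_ascProd_mul_ascProd hm (k := m + 1) (by omega)
        have h3 := ascProd_succ s (m + 1)
        change ascProd s (m + 1 + 1) * (ascProd s (m + 1) * halfTwist s m) * s (m + 1)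
          = s 0 * (ascProd s (m + 1 + 1) * (ascProd s (m + 1) * halfTwist s m))
        calc _ = ascProd s (m + 1 + 1) * (ascProd s (m + 1) * s (m + 1)) * halfTwist s m := by
              simp only [mul_assoc, hc.eq]
          _ = (s 0 * ascProd s (m + 1 + 1) * ascProd s (m + 1)) * halfTwist s m := by
              rw [h2, ← h3]
          _ = _ := by simp only [mul_assoc]

lemma semiconjBy_halfTwist_ascProd (hs : IsBraidSeq M s) {m : ℕ} (hm : m ≤ M) :
    SemiconjBy (halfTwist s m) (ascProd s m) (descProd s m) := by
  rw [← ascProd_reflect]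
  exact SemiconjBy.ascProd fun i hi => hs.semiconjBy_halfTwist hm hi

/-- Conjugation by `s (m - 1) * ⋯ * s 0` shifts the generators the other way. This follows from the
shift by `ascProd s m`, of which `descProd s m` is the conjugate under the half twist. -/
lemma semiconjBy_descProd (hs : IsBraidSeq M s) {m : ℕ} (hm : m ≤ M) {i : ℕ} (hi : i + 1 < m) :
    SemiconjBy (descProd s m) (s (i + 1)) (s i) := by
  have h1 := hs.semiconjBy_halfTwist hm (i := m - 2 - i + 1) (by omega)
  have h2 := hs.semiconjBy_halfTwist hm (i := m - 2 - i) (by omega)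
  have h3 := hs.semiconjBy_ascProd hm (i := m - 2 - i) (by omega)
  have h4 := hs.semiconjBy_halfTwist_ascProd hm
  rw [show m - 1 - (m - 2 - i + 1) = i by omega] at h1
  rw [show m - 1 - (m - 2 - i) = i + 1 by omega] at h2
  have h5 : SemiconjBy (halfTwist s m * ascProd s m) (s (m - 2 - i)) (s i) := h1.mul_left h3
  rw [h4.eq] at h5
  have h6 := h5.mul_left h2.inv_symm_left
  rwa [mul_inv_cancel_right] at h6

/-- The full twist on `m + 2` strands is the full twist on the first `m + 1` strands times the braid
in which the last strand encircles the others. -/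
lemma halfTwist_succ_sq (hs : IsBraidSeq M s) {m : ℕ} (hm : m + 1 ≤ M) :
    halfTwist s (m + 1) ^ 2 = halfTwist s m ^ 2 * (descProd s (m + 1) * ascProd s (m + 1)) := by
  have h1 := hs.semiconjBy_halfTwist_ascProd hm
  have hc : Commute (descProd s (m + 1) * ascProd s (m + 1)) (halfTwist s m) :=
    commute_halfTwist fun i hi =>
      (hs.semiconjBy_descProd hm (by omega)).mul_left (hs.semiconjBy_ascProd hm (by omega))
  calc halfTwist s (m + 1) ^ 2
      = halfTwist s (m + 1) * ascProd s (m + 1) * halfTwist s m := by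
        rw [sq, mul_assoc]; rfl
    _ = descProd s (m + 1) * ascProd s (m + 1) * (halfTwist s m * halfTwist s m) := by
        rw [h1.eq]; change _ * (_ * _) * _ = _; simp only [mul_assoc]
    _ = _ := by rw [← sq, (hc.pow_right 2).eq]

/-- Each of the `k` factors on the left contributes one occurrence of `s m`, which the shift by the
remaining factors moves to one of the last `k` generators. -/
lemma ascProd_succ_pow (hs : IsBraidSeq M s) {m : ℕ} (hm : m + 1 ≤ M) (k a : ℕ)
    (hk : a + k = m + 1) :
    ascProd s (m + 1) ^ k = ascProd s m ^ k * descProd (fun i => s (i + a)) k := by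
  induction k generalizing a with
  | zero => simp
  | succ k ih =>
    have h : SemiconjBy (ascProd s (m + 1)) (descProd (fun i => s (i + a)) k)
        (descProd (fun i => s (i + (a + 1))) k) :=
      SemiconjBy.descProd fun i hi => hs.semiconjBy_ascProd hm (i := i + a) (by omega)
    rw [pow_succ, ih (a + 1) (by omega), mul_assoc, ← h.eq, descProd_succ,
      show k + a = m by omega, ascProd_succ, pow_succ]
    simp only [mul_assoc]

/-- `s 0 * ⋯ * s (m - 1)` is an `(m + 1)`-th root of the full twist. -/
lemma ascProd_pow (hs : IsBraidSeq M s) {m : ℕ} (hm : m ≤ M) :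
    ascProd s m ^ (m + 1) = halfTwist s m ^ 2 := by
  induction m with
  | zero => simp [halfTwist]
  | succ m ih =>
    have h := hs.ascProd_succ_pow hm (m + 1) 0 (by omega)
    simp only [Nat.add_zero] at h
    rw [pow_succ, h, ih (by omega), hs.halfTwist_succ_sq hm, mul_assoc]

/-- Moving the `k` extra letters `s m` to the right past the other factors lowers their indices. -/
lemma ascProd_mul_last_pow (hs : IsBraidSeq M s) {m : ℕ} (hm : m + 1 ≤ M) (k a : ℕ)
    (hk : a + k = m + 1) :
    (ascProd s (m + 1) * s m) ^ k = ascProd s (m + 1) ^ k * ascProd (fun i => s (i + a)) k := by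
  induction k generalizing a with
  | zero => simp
  | succ k ih =>
    have h : SemiconjBy (ascProd s (m + 1)) (ascProd (fun i => s (i + a)) k)
        (ascProd (fun i => s (i + (a + 1))) k) :=
      SemiconjBy.ascProd fun i hi => hs.semiconjBy_ascProd hm (i := i + a) (by omega)
    rw [pow_succ, ih (a + 1) (by omega), mul_assoc, ← mul_assoc _ _ (s m), ← h.eq, ascProd_succ _ k,
      show k + a = m by omega, pow_succ (ascProd s (m + 1))]
    simp only [mul_assoc]

/-- `s 0 * ⋯ * s (m - 1) * s m ^ 2` is an `(m + 1)`-th root of the full twist on `m + 2` strands. -/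
lemma ascProd_mul_sq_pow (hs : IsBraidSeq M s) {m : ℕ} (hm : m + 1 ≤ M) :
    (ascProd s m * s m ^ 2) ^ (m + 1) = halfTwist s (m + 1) ^ 2 := by
  have h := hs.ascProd_mul_last_pow hm (m + 1) 0 (by omega)
  simp only [Nat.add_zero] at h
  rw [sq, ← mul_assoc, ← ascProd_succ, h, ← pow_succ, hs.ascProd_pow hm]

end IsBraidSeq

end BraidSequences

/-! ### The dicyclic group as a subgroup generated by two elements -/

section Dicyclic

variable {G : Type*} [Group G]

lemma zpow_mul_eq_mul_zpow_neg {A B : G} (h : B * A * B⁻¹ = A⁻¹) (r : ℤ) :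
    A ^ r * B = B * A ^ (-r) := by
  have h1 : SemiconjBy B A A⁻¹ := by rw [SemiconjBy, ← h]; group
  have h2 := (h1.zpow_right (-r)).eq
  rw [h2]
  simp

/-- The homomorphism from the dicyclic group of order `4 * m` determined by two elements that satisfy
its defining relations. -/
def quaternionGroupLift {m : ℕ} {A B : G} (hA : A ^ (2 * m) = 1) (hB : B ^ 2 = A ^ m)
    (hAB : B * A * B⁻¹ = A⁻¹) : QuaternionGroup m →* G :=
  let f : ZMod (2 * m) →+ Additive G :=
    ZMod.lift (2 * m) ⟨zmultiplesHom (Additive G) (Additive.ofMul A), by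
      rw [zmultiplesHom_apply, natCast_zsmul, ← ofMul_pow, hA, ofMul_one]⟩
  have hf (r : ℤ) : (f r).toMul = A ^ r := by
    simp only [f, ZMod.lift_coe, zmultiplesHom_apply]; rfl
  MonoidHom.mk'
    (fun
      | .a i => (f i).toMul
      | .xa i => B * (f i).toMul)
    (by
      rintro (i | i) (j | j) <;>
      obtain ⟨i, rfl⟩ := ZMod.intCast_surjective i <;>
      obtain ⟨j, rfl⟩ := ZMod.intCast_surjective j
      · simp only [QuaternionGroup.a_mul_a, map_add, toMul_add]
      · simp only [QuaternionGroup.a_mul_xa, ← Int.cast_sub, hf]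
        rw [← mul_assoc, zpow_mul_eq_mul_zpow_neg hAB, mul_assoc, ← zpow_add, neg_add_eq_sub]
      · simp only [QuaternionGroup.xa_mul_a, map_add, toMul_add, mul_assoc]
      · simp only [QuaternionGroup.xa_mul_xa]
        rw [← Int.cast_natCast (R := ZMod (2 * m)) m, ← Int.cast_add, ← Int.cast_sub, hf, hf, hf]
        calc A ^ ((m : ℤ) + j - i) = A ^ (m : ℤ) * (A ^ (-i) * A ^ j) := by
              rw [← zpow_add, ← zpow_add]; congr 1; ring
          _ = B * (B * A ^ (-i)) * A ^ j := by
              rw [zpow_natCast, ← hB, sq]; simp only [mul_assoc]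
          _ = B * A ^ i * (B * A ^ j) := by
              rw [← zpow_mul_eq_mul_zpow_neg hAB]; simp only [mul_assoc])

section

variable {m : ℕ} {A B : G} (hA : A ^ (2 * m) = 1) (hB : B ^ 2 = A ^ m) (hAB : B * A * B⁻¹ = A⁻¹)

lemma quaternionGroupLift_a (r : ℤ) :
    quaternionGroupLift hA hB hAB (.a r) = A ^ r := by
  change Additive.toMul (ZMod.lift (2 * m) _ (r : ZMod (2 * m))) = _
  rw [ZMod.lift_coe]
  rfl

lemma quaternionGroupLift_xa (r : ℤ) :
    quaternionGroupLift hA hB hAB (.xa r) = B * A ^ r := by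
  rw [← quaternionGroupLift_a hA hB hAB]
  rfl

lemma range_quaternionGroupLift :
    (quaternionGroupLift hA hB hAB).range = Subgroup.closure {A, B} := by
  have hAm : A ∈ Subgroup.closure {A, B} := Subgroup.subset_closure (by simp)
  have hBm : B ∈ Subgroup.closure {A, B} := Subgroup.subset_closure (by simp)
  apply le_antisymm
  · rintro _ ⟨i | i, rfl⟩ <;> obtain ⟨r, rfl⟩ := ZMod.intCast_surjective i
    · rw [quaternionGroupLift_a]
      exact zpow_mem hAm r
    · rw [quaternionGroupLift_xa]
      exact mul_mem hBm (zpow_mem hAm r)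
  · rw [Subgroup.closure_le]
    rintro g (rfl | rfl)
    · exact ⟨.a (1 : ℤ), by rw [quaternionGroupLift_a, zpow_one]⟩
    · exact ⟨.xa (0 : ℤ), by rw [quaternionGroupLift_xa, zpow_zero, mul_one]⟩

lemma mem_closure_pair_of_dicyclic {m : ℕ} {A B : G} (hA : A ^ (2 * m) = 1) (hB : B ^ 2 = A ^ m)
    (hAB : B * A * B⁻¹ = A⁻¹) {g : G} (hg : g ∈ Subgroup.closure {A, B}) :
    (∃ r : ℤ, g = A ^ r) ∨ ∃ r : ℤ, g = A ^ r * B := by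
  rw [← range_quaternionGroupLift hA hB hAB] at hg
  obtain ⟨i | i, rfl⟩ := hg <;> obtain ⟨r, rfl⟩ := ZMod.intCast_surjective i
  · exact .inl ⟨r, quaternionGroupLift_a ..⟩
  · exact .inr ⟨-r, by rw [quaternionGroupLift_xa, zpow_mul_eq_mul_zpow_neg hAB, neg_neg]⟩

end

lemma nonempty_closure_pair_mulEquiv_quaternionGroup {m : ℕ} {A B : G}
    (hA : orderOf A = 2 * m) (hB : B ^ 2 = A ^ m)
    (hAB : B * A * B⁻¹ = A⁻¹) (hBA : B ∉ Subgroup.zpowers A) :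
    Nonempty (Subgroup.closure {A, B} ≃* QuaternionGroup m) := by
  have hA' : A ^ (2 * m) = 1 := hA ▸ pow_orderOf_eq_one A
  have hinj : Function.Injective (quaternionGroupLift hA' hB hAB) := by
    rw [injective_iff_map_eq_one]
    rintro (i | i) h <;> obtain ⟨r, rfl⟩ := ZMod.intCast_surjective i
    · rw [quaternionGroupLift_a, ← orderOf_dvd_iff_zpow_eq_one, hA,
        ← ZMod.intCast_zmod_eq_zero_iff_dvd] at h
      rw [h]
      rfl
    · rw [quaternionGroupLift_xa] at h
      exact absurd ⟨-r, by simp [eq_inv_of_mul_eq_one_left h]⟩ hBA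
  exact ⟨((MonoidHom.ofInjective hinj).trans
    (MulEquiv.subgroupCongr (range_quaternionGroupLift hA' hB hAB))).symm⟩

end Dicyclic

/-! ### Adjacent transpositions and the cycles they generate -/

section Cycles

/-- The transposition of the `i`-th and `(i + 1)`-st of the letters `0, 1, 2, …`. -/
def adjSwap (i : ℕ) : Equiv.Perm ℕ := Equiv.swap i (i + 1)

lemma isBraidSeq_adjSwap (m : ℕ) : IsBraidSeq m adjSwap where
  comm i j hij _ := by
    ext t
    simp only [adjSwap, Equiv.Perm.mul_apply, Equiv.swap_apply_def]
    grind
  braid i _ := by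
    ext t
    simp only [adjSwap, Equiv.Perm.mul_apply, Equiv.swap_apply_def]
    grind

lemma ascProd_adjSwap_apply (m j : ℕ) :
    ascProd adjSwap m j = if j < m then j + 1 else if j = m then 0 else j := by
  induction m generalizing j with
  | zero => simp +contextual
  | succ m ih =>
    rw [ascProd_succ, Equiv.Perm.mul_apply, ih]
    simp only [adjSwap, Equiv.swap_apply_def]
    grind

lemma ascProd_mul_descProd_of_sq {G : Type*} [Group G] {s : ℕ → G} (hs : ∀ i, s i * s i = 1)
    (m : ℕ) : ascProd s m * descProd s m = 1 := by
  induction m with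
  | zero => simp
  | succ m ih =>
    rw [ascProd_succ, descProd_succ, mul_assoc, ← mul_assoc (s m), hs, one_mul, ih]

lemma adjSwap_mul_self (i : ℕ) : adjSwap i * adjSwap i = 1 := Equiv.swap_mul_self _ _

lemma descProd_adjSwap_ascProd_adjSwap_apply (m j : ℕ) :
    descProd adjSwap m (ascProd adjSwap m j) = j := by
  rw [← Equiv.Perm.mul_apply,
    mul_eq_one_comm.1 (ascProd_mul_descProd_of_sq adjSwap_mul_self m), Equiv.Perm.one_apply]

lemma descProd_adjSwap_succ {m j : ℕ} (hj : j < m) : descProd adjSwap m (j + 1) = j := by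
  simpa [ascProd_adjSwap_apply, hj] using descProd_adjSwap_ascProd_adjSwap_apply m j

lemma descProd_adjSwap_of_lt {m j : ℕ} (hj : m < j) : descProd adjSwap m j = j := by
  simpa [ascProd_adjSwap_apply, hj.not_gt, hj.ne'] using
    descProd_adjSwap_ascProd_adjSwap_apply m j

lemma descProd_adjSwap_pow_apply {m t : ℕ} (ht : t ≤ m) :
    (descProd adjSwap m ^ t) m = m - t := by
  induction t with
  | zero => simp
  | succ t ih =>
    rw [pow_succ', Equiv.Perm.mul_apply, ih (by omega), show m - t = m - (t + 1) + 1 by omega,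
      descProd_adjSwap_succ (by omega)]

lemma ascProd_adjSwap_pow_apply_zero (m r : ℕ) : (ascProd adjSwap m ^ r) 0 = r % (m + 1) := by
  induction r with
  | zero => simp
  | succ r ih =>
    have hr : r % (m + 1) < m + 1 := Nat.mod_lt _ (by omega)
    rw [pow_succ', Equiv.Perm.mul_apply, ih, ascProd_adjSwap_apply]
    split_ifs with h1 h2
    · rw [← Nat.mod_add_mod, Nat.mod_eq_of_lt (a := r % (m + 1) + 1) (by omega)]
    · rw [← Nat.mod_add_mod, h2, Nat.mod_self]
    · omega

lemma dvd_of_ascProd_adjSwap_pow_eq_one {m r : ℕ} (h : ascProd adjSwap m ^ r = 1) :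
    m + 1 ∣ r := by
  have := ascProd_adjSwap_pow_apply_zero m r
  rw [h, Equiv.Perm.one_apply] at this
  exact Nat.dvd_of_mod_eq_zero this.symm

end Cycles

/-! ### An action that detects the full twist -/

section SpinAction

/-- The action of the generator `σ_{i+1}` of `B_n(S²)` on pairs `(χ, c)` of a labelling `χ` of the
strands and a counter `c`, both with values modulo `4`: the two labels at `i` and `i + 1` are swapped,
and the counter is increased by their product times the sum of all labels.  That factor, which the
action preserves, makes the relation of the sphere hold for all labellings at once. -/
def spinPerm (n i : ℕ) : Equiv.Perm ((ℕ → ZMod 4) × ZMod 4) where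
  toFun v := (v.1 ∘ adjSwap i, v.2 + (∑ t ∈ Finset.range n, v.1 t) * (v.1 i * v.1 (i + 1)))
  invFun v := (v.1 ∘ adjSwap i,
    v.2 - (∑ t ∈ Finset.range n, v.1 (adjSwap i t)) * (v.1 i * v.1 (i + 1)))
  left_inv v := by
    ext
    · simp [adjSwap]
    · simp [adjSwap, mul_comm]
  right_inv v := by
    ext
    · simp [adjSwap]
    · simp [adjSwap, mul_comm]

lemma sum_range_adjSwap {n i : ℕ} (hi : i + 1 < n) (χ : ℕ → ZMod 4) :
    ∑ t ∈ Finset.range n, χ (adjSwap i t) = ∑ t ∈ Finset.range n, χ t :=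
  Equiv.Perm.sum_comp _ _ _ fun t ht => by
    by_contra h
    simp only [Finset.coe_range, Set.mem_Iio] at h
    exact ht (Equiv.swap_apply_of_ne_of_ne (by omega) (by omega))

lemma sum_range_descProd_adjSwap {n m : ℕ} (hm : m < n) (χ : ℕ → ZMod 4) :
    ∑ t ∈ Finset.range n, χ (descProd adjSwap m t) = ∑ t ∈ Finset.range n, χ t :=
  Equiv.Perm.sum_comp _ _ _ fun t ht => by
    by_contra h
    simp only [Finset.coe_range, Set.mem_Iio] at h
    exact ht (descProd_adjSwap_of_lt (by omega))

lemma sum_range_ascProd_adjSwap {n m : ℕ} (hm : m < n) (χ : ℕ → ZMod 4) :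
    ∑ t ∈ Finset.range n, χ (ascProd adjSwap m t) = ∑ t ∈ Finset.range n, χ t :=
  Equiv.Perm.sum_comp _ _ _ fun t ht => by
    by_contra h
    simp only [Finset.coe_range, Set.mem_Iio] at h
    exact ht (by rw [ascProd_adjSwap_apply, if_neg (by omega), if_neg (by omega)])

lemma spinPerm_apply (n i : ℕ) (χ : ℕ → ZMod 4) (c : ZMod 4) :
    spinPerm n i (χ, c) =
      (χ ∘ adjSwap i, c + (∑ t ∈ Finset.range n, χ t) * (χ i * χ (i + 1))) := rfl

lemma isBraidSeq_spinPerm (n : ℕ) : IsBraidSeq (n - 1) (spinPerm n) where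
  comm i j hij hj := by
    ext1 ⟨χ, c⟩
    simp only [Equiv.Perm.mul_apply, spinPerm_apply, Function.comp_apply,
      sum_range_adjSwap (show i + 1 < n by omega), sum_range_adjSwap (show j + 1 < n by omega)]
    have h := (isBraidSeq_adjSwap (n - 1)).comm i j hij hj
    rw [Function.comp_assoc, Function.comp_assoc, ← Equiv.Perm.coe_mul, ← Equiv.Perm.coe_mul, h]
    have h1 : adjSwap i j = j := Equiv.swap_apply_of_ne_of_ne (by omega) (by omega)
    have h2 : adjSwap i (j + 1) = j + 1 := Equiv.swap_apply_of_ne_of_ne (by omega) (by omega)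
    have h3 : adjSwap j i = i := Equiv.swap_apply_of_ne_of_ne (by omega) (by omega)
    have h4 : adjSwap j (i + 1) = i + 1 := Equiv.swap_apply_of_ne_of_ne (by omega) (by omega)
    rw [h1, h2, h3, h4]
    congr 1
    ring
  braid i hi := by
    ext1 ⟨χ, c⟩
    have h := (isBraidSeq_adjSwap (n - 1)).braid i hi
    have hi0 : i + 1 < n := by omega
    have hi1 : i + 1 + 1 < n := by omega
    have h1 : adjSwap i i = i + 1 := Equiv.swap_apply_left _ _
    have h2 : adjSwap i (i + 1) = i := Equiv.swap_apply_right _ _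
    have h3 : adjSwap i (i + 1 + 1) = i + 1 + 1 :=
      Equiv.swap_apply_of_ne_of_ne (by omega) (by omega)
    have h4 : adjSwap (i + 1) i = i := Equiv.swap_apply_of_ne_of_ne (by omega) (by omega)
    have h5 : adjSwap (i + 1) (i + 1) = i + 1 + 1 := Equiv.swap_apply_left _ _
    have h6 : adjSwap (i + 1) (i + 1 + 1) = i + 1 := Equiv.swap_apply_right _ _
    simp only [Equiv.Perm.mul_apply, spinPerm_apply, Function.comp_apply]
    have e1 := sum_range_adjSwap hi0 χ
    have e2 := sum_range_adjSwap hi1 χ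
    have e3 := sum_range_adjSwap hi1 (χ ∘ adjSwap i)
    have e4 := sum_range_adjSwap hi0 (χ ∘ adjSwap (i + 1))
    simp only [Function.comp_apply] at e3 e4
    rw [e3, e4, e1, e2]
    rw [Function.comp_assoc, Function.comp_assoc, Function.comp_assoc, Function.comp_assoc]
    simp only [← Equiv.Perm.coe_mul]
    rw [← mul_assoc, ← mul_assoc, h, h2, h3, h4, h5, h6]
    simp only [h1, h3]
    congr 1
    ring

lemma ascProd_spinPerm_apply {n m : ℕ} (hm : m < n) (χ : ℕ → ZMod 4) (c : ZMod 4) :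
    ascProd (spinPerm n) m (χ, c) = (χ ∘ (descProd adjSwap m : Equiv.Perm ℕ),
      c + (∑ t ∈ Finset.range n, χ t) * (χ m * ∑ t ∈ Finset.range m, χ t)) := by
  induction m generalizing χ c with
  | zero => simp
  | succ m ih =>
    have h : ∑ t ∈ Finset.range m, χ (adjSwap m t) = ∑ t ∈ Finset.range m, χ t :=
      Finset.sum_congr rfl fun t ht => by
        have := Finset.mem_range.1 ht
        rw [adjSwap, Equiv.swap_apply_of_ne_of_ne (by omega) (by omega)]
    rw [ascProd_succ, Equiv.Perm.mul_apply, spinPerm_apply, ih (by omega), descProd_succ]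
    simp only [Function.comp_apply, sum_range_adjSwap hm, h, Finset.sum_range_succ χ m]
    rw [Function.comp_assoc, ← Equiv.Perm.coe_mul, show adjSwap m m = m + 1 from
      Equiv.swap_apply_left _ _]
    congr 1
    ring

lemma descProd_spinPerm_apply {n m : ℕ} (hm : m < n) (χ : ℕ → ZMod 4) (c : ZMod 4) :
    descProd (spinPerm n) m (χ, c) = (χ ∘ (ascProd adjSwap m : Equiv.Perm ℕ),
      c + (∑ t ∈ Finset.range n, χ t) * (χ 0 * ∑ t ∈ Finset.range m, χ (t + 1))) := by
  induction m with
  | zero => simp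
  | succ m ih =>
    rw [descProd_succ, Equiv.Perm.mul_apply, ih (by omega), spinPerm_apply, ascProd_succ]
    simp only [Function.comp_apply, sum_range_ascProd_adjSwap (show m < n by omega),
      Finset.sum_range_succ _ m]
    rw [Function.comp_assoc, ← Equiv.Perm.coe_mul, ascProd_adjSwap_apply, ascProd_adjSwap_apply,
      if_neg (by omega), if_pos rfl, if_neg (by omega), if_neg (by omega)]
    congr 1
    ring

/-- A strand that travels once around all the others adds twice the product of its label with the
other labels; multiplied by the sum of all labels, this vanishes modulo `4`. -/
lemma ascProd_mul_descProd_spinPerm (p : ℕ) :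
    ascProd (spinPerm (p + 1)) p * descProd (spinPerm (p + 1)) p = 1 := by
  ext1 ⟨χ, c⟩
  have key : ∀ S u : ZMod 4, S * (u * (S - u)) + S * (u * (S - u)) = 0 := by decide
  rw [Equiv.Perm.mul_apply, descProd_spinPerm_apply (by omega), ascProd_spinPerm_apply (by omega),
    Equiv.Perm.one_apply]
  have h0 : ascProd adjSwap p p = 0 := by simp [ascProd_adjSwap_apply]
  have e0 := sum_range_ascProd_adjSwap (Nat.lt_succ_self p) χ
  have e1 := Finset.sum_range_succ' χ p
  have e2 := Finset.sum_range_succ (fun t => χ (ascProd adjSwap p t)) p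
  rw [e0, h0] at e2
  have e3 := key (∑ t ∈ Finset.range (p + 1), χ t) (χ 0)
  rw [Function.comp_assoc, ← Equiv.Perm.coe_mul, ascProd_mul_descProd_of_sq adjSwap_mul_self]
  simp only [Function.comp_apply, e0, h0]
  rw [eq_sub_of_add_eq e1.symm, eq_sub_of_add_eq e2.symm, add_assoc, e3, add_zero]
  rfl

/-- With `S` the sum of the labels, each turn of the cycle brings the next strand `u` to the last
position and carries it across all the others, which adds `S * (χ u * (S - χ u))`. -/
lemma ascProd_spinPerm_pow_apply (p r : ℕ) (χ : ℕ → ZMod 4) (c : ZMod 4) :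
    (ascProd (spinPerm (p + 1)) p ^ r) (χ, c) = (χ ∘ (descProd adjSwap p ^ r : Equiv.Perm ℕ),
      c + ∑ t ∈ Finset.range r, (∑ t ∈ Finset.range (p + 1), χ t) *
        (χ ((descProd adjSwap p ^ t) p) *
          ((∑ t ∈ Finset.range (p + 1), χ t) - χ ((descProd adjSwap p ^ t) p)))) := by
  induction r generalizing χ c with
  | zero => simp
  | succ r ih =>
    rw [pow_succ, Equiv.Perm.mul_apply, ascProd_spinPerm_apply (by omega), ih,
      Finset.sum_range_succ' _ r]
    simp only [Function.comp_apply, sum_range_descProd_adjSwap (Nat.lt_succ_self p),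
      ← Equiv.Perm.mul_apply, ← pow_succ']
    rw [Function.comp_assoc, ← Equiv.Perm.coe_mul, ← pow_succ', pow_zero, Equiv.Perm.one_apply,
      Finset.sum_range_succ χ p]
    congr 1
    ring

/-- In the action on labelled strands, the full twist moves the counter by `2` if exactly three of the
strands carry the label `1` and all other labels vanish. -/
lemma ascProd_spinPerm_pow_ne_one {p : ℕ} (hp : 2 ≤ p) :
    ascProd (spinPerm (p + 1)) p ^ (p + 1) ≠ 1 := by
  intro h
  obtain ⟨d, rfl⟩ := Nat.exists_eq_add_of_le hp
  -- Each of the three strands contributes `3 * (1 * (3 - 1)) = 6`, in total `18 = 2` modulo `4`.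
  have h1 := ascProd_spinPerm_pow_apply (2 + d) (2 + d + 1) (fun t => if t < 3 then 1 else 0) 0
  rw [h, Equiv.Perm.one_apply] at h1
  have h2 := congrArg Prod.snd h1
  have hsum (f : ℕ → ZMod 4) (hf : ∀ t, 3 ≤ t → f t = 0) :
      ∑ t ∈ Finset.range (2 + d + 1), f t = f 0 + f 1 + f 2 := by
    rw [show 2 + d + 1 = 3 + d by omega, Finset.sum_range_add,
      Finset.sum_eq_zero (s := Finset.range d) (fun t _ => hf _ (by omega))]
    simp [Finset.sum_range_succ]
  have hS : ∑ t ∈ Finset.range (2 + d + 1), (if t < 3 then (1 : ZMod 4) else 0) = 3 := by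
    rw [hsum _ fun t ht => if_neg (by omega)]
    decide
  rw [hS] at h2
  have hrefl := Finset.sum_range_reflect
    (fun t => (3 : ZMod 4) * ((if t < 3 then 1 else 0) * (3 - if t < 3 then 1 else 0)))
    (2 + d + 1)
  rw [hsum (fun t => (3 : ZMod 4) * ((if t < 3 then 1 else 0) * (3 - if t < 3 then 1 else 0)))
    fun t ht => by rw [if_neg (by omega)]; ring] at hrefl
  rw [Finset.sum_congr rfl fun t ht => by
    rw [descProd_adjSwap_pow_apply (show t ≤ 2 + d by have := Finset.mem_range.1 ht; omega)]] at h2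
  rw [show 2 + d + 1 - 1 = 2 + d from rfl] at hrefl
  rw [hrefl] at h2
  dsimp only at h2
  revert h2
  decide

end SpinAction

/-! ### Roots of the full twist in the braid group of the sphere -/

section SphereBraidGroup

open SphereBraidGroup

lemma isBraidSeq_sigma (n : ℕ) : IsBraidSeq (n - 1) fun i => sigma n (i + 1) where
  comm i j hij hj := by
    refine mul_inv_eq_one.1 (PresentedGroup.one_of_mem (rels := sphereBraidRels n) (x :=
      (sphereBraidLetter n (i + 1) * sphereBraidLetter n (j + 1)) *
      (sphereBraidLetter n (j + 1) * sphereBraidLetter n (i + 1))⁻¹) (.inl (.inl ?_)))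
    exact ⟨i + 1, j + 1, by omega, by omega, by omega, by omega, by omega, rfl⟩
  braid i hi := by
    refine mul_inv_eq_one.1 (PresentedGroup.one_of_mem (rels := sphereBraidRels n) (x :=
      (sphereBraidLetter n (i + 1) * sphereBraidLetter n (i + 2) * sphereBraidLetter n (i + 1)) *
      (sphereBraidLetter n (i + 2) * sphereBraidLetter n (i + 1) *
        sphereBraidLetter n (i + 2))⁻¹) (.inl (.inr ?_)))
    exact ⟨i + 1, by omega, by omega, rfl⟩

lemma ascProd_mul_descProd_sigma {n : ℕ} (hn : 2 ≤ n) :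
    ascProd (fun i => sigma n (i + 1)) (n - 1) * descProd (fun i => sigma n (i + 1)) (n - 1)
      = 1 := by
  have h : PresentedGroup.mk (sphereBraidRels n) _ = 1 := PresentedGroup.one_of_mem (.inr rfl)
  simp only [map_mul, map_pow, map_list_prod, List.map_map] at h
  obtain ⟨p, rfl⟩ := Nat.exists_eq_add_of_le' hn
  change ascProd _ (p + 1) * descProd _ (p + 1) = 1
  rw [ascProd_succ, descProd_succ]
  rw [sq] at h
  simp only [mul_assoc] at h ⊢
  exact h

lemma lift_sphereBraidLetter {H : Type*} [Group H] {n i : ℕ} (hi : i < n - 1) (t : ℕ → H) :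
    FreeGroup.lift (fun j : Fin (n - 1) => t j) (sphereBraidLetter n (i + 1)) = t i := by
  rw [sphereBraidLetter, dif_pos ⟨by omega, by omega⟩, FreeGroup.lift_apply_of]
  rfl

/-- The universal property of the presentation of `B_n(S²)`. -/
lemma exists_hom_sphereBraidGroup {H : Type*} [Group H] {n : ℕ} (hn : 2 ≤ n) {t : ℕ → H}
    (ht : IsBraidSeq (n - 1) t) (h1 : ascProd t (n - 1) * descProd t (n - 1) = 1) :
    ∃ φ : SphereBraidGroup n →* H, ∀ i < n - 1, φ (sigma n (i + 1)) = t i := by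
  have hl (i : ℕ) (hi : i < n - 1) := lift_sphereBraidLetter hi t
  have hrel : ∀ r ∈ sphereBraidRels n,
      FreeGroup.lift (fun j : Fin (n - 1) => t j) r = 1 := by
    rintro r ((⟨i, j, hi, hi', hj, hj', hij, rfl⟩ | ⟨i, hi, hi', rfl⟩) | rfl)
    · obtain ⟨i, rfl⟩ := Nat.exists_eq_add_of_le' hi
      obtain ⟨j, rfl⟩ := Nat.exists_eq_add_of_le' hj
      simp only [map_mul, map_inv, hl i (by omega), hl j (by omega)]
      rw [mul_inv_eq_one]
      rcases hij with h | h
      · exact ht.comm i j (by omega) (by omega)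
      · exact (ht.comm j i (by omega) (by omega)).symm
    · obtain ⟨i, rfl⟩ := Nat.exists_eq_add_of_le' hi
      simp only [map_mul, map_inv, hl i (by omega), hl (i + 1) (by omega)]
      rw [mul_inv_eq_one]
      exact ht.braid i (by omega)
    · obtain ⟨p, rfl⟩ := Nat.exists_eq_add_of_le' hn
      have e1 := map_ascProd (FreeGroup.lift fun j : Fin (p + 2 - 1) => t j)
        (fun i => sphereBraidLetter (p + 2) (i + 1)) p
      have e2 := map_descProd (FreeGroup.lift fun j : Fin (p + 2 - 1) => t j)
        (fun i => sphereBraidLetter (p + 2) (i + 1)) p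
      rw [ascProd_congr fun i hi => hl i (by omega)] at e1
      rw [descProd_congr fun i hi => hl i (by omega)] at e2
      rw [map_mul, map_mul, map_pow]
      change FreeGroup.lift _ (ascProd _ p) * FreeGroup.lift _ (sphereBraidLetter (p + 2) (p + 1))
        ^ 2 * FreeGroup.lift _ (descProd _ p) = 1
      rw [e1, e2, hl p (by omega), ← h1, show p + 2 - 1 = p + 1 by omega, ascProd_succ,
        descProd_succ, sq]
      simp only [mul_assoc]
  refine ⟨PresentedGroup.toGroup hrel, fun i hi => ?_⟩
  exact hl i hi

namespace SphereBraidGroup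

variable {n : ℕ}

lemma ascending_eq_ascProd (n m : ℕ) :
    ascending n m = ascProd (fun i => sigma n (i + 1)) m := rfl

lemma garside_eq_halfTwist (n : ℕ) :
    garside n = halfTwist (fun i => sigma n (i + 1)) (n - 1) := by
  rw [halfTwist_eq_prod]
  rfl

lemma map_ascending {H : Type*} [Group H] {t : ℕ → H} {φ : SphereBraidGroup n →* H}
    (hφ : ∀ i < n - 1, φ (sigma n (i + 1)) = t i) {m : ℕ} (hm : m ≤ n - 1) :
    φ (ascending n m) = ascProd t m := by
  rw [ascending_eq_ascProd, map_ascProd]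
  exact ascProd_congr fun i hi => hφ i (by omega)

lemma alpha0_pow (hn : 1 ≤ n) : alpha0 n ^ n = garside n ^ 2 := by
  have h := (isBraidSeq_sigma n).ascProd_pow le_rfl
  rw [Nat.sub_add_cancel hn] at h
  rw [garside_eq_halfTwist, ← h]
  rfl

/-- In `B_n(S²)` the last strand may be pulled off the others around the sphere, so that the full
twist on all strands is the full twist on all but one of them. -/
lemma alpha2_pow (hn : 3 ≤ n) : alpha2 n ^ (n - 2) = garside n ^ 2 := by
  have hs := isBraidSeq_sigma n
  have h := hs.ascProd_mul_sq_pow (m := n - 3) (by omega)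
  have h2 := hs.halfTwist_succ_sq (m := n - 2) (by omega)
  have h3 := mul_eq_one_comm.1 (ascProd_mul_descProd_sigma (show 2 ≤ n by omega))
  rw [show n - 2 + 1 = n - 1 by omega, h3, mul_one] at h2
  rw [show n - 3 + 1 = n - 2 by omega, ← h2] at h
  rw [garside_eq_halfTwist, ← h]
  rfl

/-- The half twist turns `α₀` into `σ_{n-1} ⋯ σ_1`, which is the inverse of `α₀` by the relation of the
sphere. -/
lemma garside_mul_alpha0 (hn : 2 ≤ n) : garside n * alpha0 n * (garside n)⁻¹ = (alpha0 n)⁻¹ := by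
  have h := (isBraidSeq_sigma n).semiconjBy_halfTwist_ascProd le_rfl
  rw [garside_eq_halfTwist, alpha0, ascending_eq_ascProd, h.eq, mul_inv_cancel_right]
  exact eq_inv_of_mul_eq_one_right (ascProd_mul_descProd_sigma hn)

lemma sigma_mul_conj_alpha2 (hn : 3 ≤ n) :
    sigma n 1 * (alpha0 n * alpha2 n * (alpha0 n)⁻¹) = alpha0 n * sigma n (n - 1) := by
  have hs := isBraidSeq_sigma n
  have h1 := hs.zero_mul_ascProd_mul_ascProd le_rfl (k := n - 3) (by omega)
  have h2 := hs.semiconjBy_ascProd le_rfl (i := n - 3) (by omega)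
  have h3 := ascProd_succ (fun i => sigma n (i + 1)) (n - 2)
  rw [show n - 3 + 1 = n - 2 by omega] at h1
  simp only [show n - 3 + 1 = n - 2 by omega, show n - 2 + 1 = n - 1 by omega] at h2 h3
  simp only [← ascending_eq_ascProd] at h1 h2 h3
  rw [← mul_assoc, ← mul_assoc, mul_inv_eq_iff_eq_mul, alpha2, ← mul_assoc]
  change sigma n 1 * alpha0 n * ascending n (n - 3) = _ at h1
  rw [h1, mul_assoc, (h2.pow_right 2).eq, sq, ← mul_assoc, ← mul_assoc, ← h3]
  rfl

/-- Writing the conjugate of `α₂` as `σ_1⁻¹ α₀ σ_{n-1}`, conjugation by the half twist exchanges `σ_1`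
and `σ_{n-1}` and inverts `α₀`. -/
lemma garside_mul_conj_alpha2 (hn : 3 ≤ n) :
    garside n * (alpha0 n * alpha2 n * (alpha0 n)⁻¹) * (garside n)⁻¹ =
      (alpha0 n * alpha2 n * (alpha0 n)⁻¹)⁻¹ := by
  have hs := isBraidSeq_sigma n
  have h0 : alpha0 n * alpha2 n * (alpha0 n)⁻¹ = (sigma n 1)⁻¹ * (alpha0 n * sigma n (n - 1)) :=
    eq_inv_mul_of_mul_eq (sigma_mul_conj_alpha2 hn)
  have h1 := hs.semiconjBy_halfTwist le_rfl (i := 0) (by omega)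
  have h2 := hs.semiconjBy_halfTwist le_rfl (i := n - 2) (by omega)
  simp only [← garside_eq_halfTwist] at h1 h2
  rw [show n - 1 - 1 - 0 + 1 = n - 1 by omega, show 0 + 1 = 1 from rfl] at h1
  rw [show n - 1 - 1 - (n - 2) + 1 = 1 by omega, show n - 2 + 1 = n - 1 by omega] at h2
  have h3 : SemiconjBy (garside n) (alpha0 n) (alpha0 n)⁻¹ :=
    mul_inv_eq_iff_eq_mul.1 (garside_mul_alpha0 (by omega))
  rw [h0, (h1.inv_right.mul_right (h3.mul_right h2)).eq]
  group

lemma garside_sq_ne_one (hn : 3 ≤ n) : garside n ^ 2 ≠ 1 := by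
  obtain ⟨p, rfl⟩ := Nat.exists_eq_add_of_le' (show 1 ≤ n by omega)
  obtain ⟨φ, hφ⟩ := exists_hom_sphereBraidGroup (show 2 ≤ p + 1 by omega)
    (isBraidSeq_spinPerm (p + 1)) (ascProd_mul_descProd_spinPerm p)
  intro h
  rw [← alpha0_pow (by omega)] at h
  have h' := congrArg φ h
  rw [map_pow, alpha0, map_ascending hφ le_rfl, map_one] at h'
  exact ascProd_spinPerm_pow_ne_one (by omega) h'

/-- The permutation of the strands induced by a spherical braid. -/
lemma exists_permHom (hn : 2 ≤ n) :
    ∃ φ : SphereBraidGroup n →* Equiv.Perm ℕ, ∀ i < n - 1, φ (sigma n (i + 1)) = adjSwap i :=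
  exists_hom_sphereBraidGroup hn (isBraidSeq_adjSwap _)
    (ascProd_mul_descProd_of_sq adjSwap_mul_self _)

lemma dvd_of_alpha0_pow_eq_one (hn : 2 ≤ n) {r : ℕ} (h : alpha0 n ^ r = 1) : n ∣ r := by
  obtain ⟨φ, hφ⟩ := exists_permHom hn
  have h' := congrArg φ h
  rw [map_pow, alpha0, map_ascending hφ le_rfl, map_one] at h'
  have := dvd_of_ascProd_adjSwap_pow_eq_one h'
  rwa [Nat.sub_add_cancel (by omega)] at this

/-- In the symmetric group the square in `α₂` disappears, so that `α₂` becomes a cycle of length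
`n - 2`. -/
lemma dvd_of_alpha2_pow_eq_one (hn : 3 ≤ n) {r : ℕ} (h : alpha2 n ^ r = 1) : n - 2 ∣ r := by
  obtain ⟨φ, hφ⟩ := exists_permHom (show 2 ≤ n by omega)
  have h' := congrArg φ h
  have h1 := hφ (n - 3) (by omega)
  rw [show n - 3 + 1 = n - 2 by omega] at h1
  rw [map_pow, alpha2, map_mul, map_pow, map_ascending hφ (by omega), map_one, h1, sq,
    adjSwap_mul_self, mul_one] at h'
  have := dvd_of_ascProd_adjSwap_pow_eq_one h'
  rwa [show n - 3 + 1 = n - 2 by omega] at this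

section Exponent

lemma ascProd_const {G : Type*} [Group G] (g : G) (m : ℕ) :
    ascProd (fun _ => g) m = g ^ m := by
  simp [ascProd]

/-- The exponent sum of a spherical braid, which is defined modulo `2 * (n - 1)`. -/
lemma exists_exponentHom (hn : 2 ≤ n) :
    ∃ φ : SphereBraidGroup n →* Multiplicative (ZMod (2 * (n - 1))),
      ∀ i < n - 1, φ (sigma n (i + 1)) = Multiplicative.ofAdd 1 := by
  refine exists_hom_sphereBraidGroup hn (t := fun _ => Multiplicative.ofAdd 1)
    ⟨fun _ _ _ _ => rfl, fun _ _ => rfl⟩ ?_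
  rw [← ascProd_reflect, ascProd_const, ← pow_add, ← two_mul, ← ofAdd_nsmul, nsmul_one,
    ZMod.natCast_self, ofAdd_zero]

lemma map_halfTwist {H : Type*} [Group H] (φ : SphereBraidGroup n →* H) {g : H}
    (hφ : ∀ i < n - 1, φ (sigma n (i + 1)) = g) {m : ℕ} (hm : m ≤ n - 1) :
    φ (halfTwist (fun i => sigma n (i + 1)) m) = g ^ ∑ i ∈ Finset.range (m + 1), i := by
  induction m with
  | zero => simp [halfTwist]
  | succ m ih =>
    rw [halfTwist, map_mul, ← ascending_eq_ascProd, map_ascending hφ hm, ascProd_const,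
      ih (by omega), Finset.sum_range_succ _ (m + 1), pow_add, ← pow_add, ← pow_add, add_comm]

lemma map_garside {H : Type*} [Group H] (φ : SphereBraidGroup n →* H) {g : H} (hn : 1 ≤ n)
    (hn_even : Even n) (hφ : ∀ i < n - 1, φ (sigma n (i + 1)) = g) :
    φ (garside n) = (g ^ (n - 1)) ^ (n / 2) := by
  obtain ⟨p, rfl⟩ := hn_even
  rw [garside_eq_halfTwist, map_halfTwist φ hφ le_rfl, ← pow_mul, Finset.sum_range_id]
  congr 1
  rw [show p + p - 1 + 1 = 2 * p by omega, show p + p - 1 = 2 * p - 1 by omega,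
    show (p + p) / 2 = p by omega, mul_assoc, Nat.mul_div_cancel_left _ two_pos, mul_comm]

end Exponent

end SphereBraidGroup

end SphereBraidGroup

/-! ### Dicyclic subgroups generated by powers of an inverted element -/

section DicyclicFamily

variable {G : Type*} [Group G] {x D : G} {N : ℕ}

/-- If `x ^ N` is the nontrivial square of an element inverting `x`, and `N` divides every exponent
that kills `x`, then `x` has order `2 * N`: the square is an involution. -/
lemma orderOf_eq_two_mul_of_conj_eq_inv (hN : 1 ≤ N) (hdvd : ∀ r : ℕ, x ^ r = 1 → N ∣ r)
    (hD : x ^ N = D ^ 2) (hD1 : D ^ 2 ≠ 1) (hxD : D * x * D⁻¹ = x⁻¹) : orderOf x = 2 * N := by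
  -- `D` commutes with its square `x ^ N` but also inverts it.
  have h1 : x ^ (2 * N) = 1 := by
    have h2 : D * x ^ N * D⁻¹ = (x ^ N)⁻¹ := by rw [← conj_pow, hxD, inv_pow]
    have h3 : D * x ^ N * D⁻¹ = x ^ N := by rw [hD]; group
    rw [h3] at h2
    rw [two_mul, pow_add]
    nth_rw 1 [h2]
    simp
  obtain ⟨t, ht⟩ := hdvd _ (pow_orderOf_eq_one x)
  have h4 : t ∣ 2 := by
    have := orderOf_dvd_of_pow_eq_one h1
    rw [ht, mul_comm] at this
    exact Nat.dvd_of_mul_dvd_mul_right hN this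
  rcases (Nat.dvd_prime Nat.prime_two).1 h4 with rfl | rfl
  · rw [mul_one] at ht
    exact absurd (hD ▸ ht ▸ pow_orderOf_eq_one x) hD1
  · rw [ht, mul_comm]

lemma notMem_zpowers_of_conj_eq_inv (hN : 2 ≤ N) (hx : orderOf x = 2 * N)
    (hxD : D * x * D⁻¹ = x⁻¹) : D ∉ Subgroup.zpowers x := by
  rintro ⟨r, rfl⟩
  have h : x ^ 2 = 1 := by
    have h1 : x = x⁻¹ := by
      rw [← hxD, ← zpow_neg, ← zpow_add_one, ← zpow_add]
      simp
    rw [sq]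
    nth_rw 1 [h1]
    simp
  have := Nat.le_of_dvd two_pos (orderOf_dvd_of_pow_eq_one h)
  omega

lemma pow_mul_conj_pow_eq_inv (hxD : D * x * D⁻¹ = x⁻¹) (d e : ℕ) :
    x ^ e * D * x ^ d * (x ^ e * D)⁻¹ = (x ^ d)⁻¹ := by
  calc x ^ e * D * x ^ d * (x ^ e * D)⁻¹ = x ^ e * (D * x ^ d * D⁻¹) * (x ^ e)⁻¹ := by group
    _ = (x ^ d)⁻¹ := by rw [← conj_pow, hxD]; group

lemma pow_mul_sq_eq_sq (hxD : D * x * D⁻¹ = x⁻¹) (e : ℕ) : (x ^ e * D) ^ 2 = D ^ 2 := by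
  have h : D * x ^ e * D⁻¹ = (x ^ e)⁻¹ := by rw [← conj_pow, hxD, inv_pow]
  rw [mul_inv_eq_iff_eq_mul] at h
  rw [sq, mul_assoc, ← mul_assoc D, h, mul_assoc, mul_inv_cancel_left, sq]

/-- Conjugation by `x ^ t` multiplies `x ^ e * D` by `x ^ (2 * t)`. -/
lemma zpow_conj_pow_mul (hxD : D * x * D⁻¹ = x⁻¹) {t : ℤ} {e e' : ℕ} (h : 2 * t = (e' : ℤ) - e) :
    x ^ t * (x ^ e * D) * (x ^ t)⁻¹ = x ^ e' * D := by
  rw [← zpow_neg, mul_assoc, mul_assoc, ← zpow_mul_eq_mul_zpow_neg hxD, ← mul_assoc,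
    ← mul_assoc, ← zpow_natCast, ← zpow_natCast, ← zpow_add,
    ← zpow_add]
  congr 2
  linarith

lemma nonempty_closure_pow_mulEquiv_quaternionGroup (hN : 2 ≤ N) (hx : orderOf x = 2 * N)
    (hD : x ^ N = D ^ 2) (hxD : D * x * D⁻¹ = x⁻¹) {d m : ℕ} (hdm : N = d * m) (e : ℕ) :
    Nonempty (Subgroup.closure {x ^ d, x ^ e * D} ≃* QuaternionGroup m) := by
  have hd : d ≠ 0 := by rintro rfl; omega
  refine nonempty_closure_pair_mulEquiv_quaternionGroup ?_ ?_
    (pow_mul_conj_pow_eq_inv hxD d e) ?_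
  · rw [orderOf_pow_of_dvd hd (hx ▸ hdm ▸ ⟨2 * m, by ring⟩), hx, hdm, mul_left_comm,
      Nat.mul_div_cancel_left _ (Nat.pos_of_ne_zero hd)]
  · rw [pow_mul_sq_eq_sq hxD, ← pow_mul, ← hdm, hD]
  · intro h
    have hxe : x ^ e ∈ Subgroup.zpowers x := pow_mem (Subgroup.mem_zpowers x) e
    have hle : Subgroup.zpowers (x ^ d) ≤ Subgroup.zpowers x :=
      Subgroup.zpowers_le.2 (pow_mem (Subgroup.mem_zpowers x) d)
    exact notMem_zpowers_of_conj_eq_inv hN hx hxD ((Subgroup.mul_mem_cancel_left _ hxe).1 (hle h))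

lemma dvd_sub_of_mem_closure_pow (hN : 2 ≤ N) (hx : orderOf x = 2 * N)
    (hD : x ^ N = D ^ 2) (hxD : D * x * D⁻¹ = x⁻¹) {d m : ℕ} (hdm : N = d * m) {e e' : ℕ}
    (h : x ^ e * D ∈ Subgroup.closure {x ^ d, x ^ e' * D}) : (d : ℤ) ∣ (e : ℤ) - e' := by
  have hA : (x ^ d) ^ (2 * m) = 1 := by
    rw [← pow_mul, mul_left_comm, ← hdm, ← hx, pow_orderOf_eq_one]
  have hB : (x ^ e' * D) ^ 2 = (x ^ d) ^ m := by
    rw [pow_mul_sq_eq_sq hxD, ← pow_mul, ← hdm, hD]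
  rcases mem_closure_pair_of_dicyclic hA hB (pow_mul_conj_pow_eq_inv hxD d e') h with
    ⟨r, hr⟩ | ⟨r, hr⟩
  · refine absurd ?_ (notMem_zpowers_of_conj_eq_inv hN hx hxD)
    rw [← eq_inv_mul_iff_mul_eq] at hr
    rw [hr]
    exact mul_mem (inv_mem (pow_mem (Subgroup.mem_zpowers x) e))
      (zpow_mem (pow_mem (Subgroup.mem_zpowers x) d) r)
  · rw [← mul_assoc, mul_left_inj, ← zpow_natCast, ← zpow_natCast, ← zpow_natCast, ← zpow_mul,
      ← zpow_add, zpow_eq_zpow_iff_modEq, hx] at hr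
    have h1 : (d : ℤ) ∣ ((2 * N : ℕ) : ℤ) := ⟨2 * m, by rw [hdm]; push_cast; ring⟩
    have h2 := (h1.trans hr.symm.dvd)
    have h3 : (e : ℤ) - e' = (e - (d * r + e')) + d * r := by ring
    rw [h3]
    exact dvd_add h2 (dvd_mul_right _ _)

end DicyclicFamily

/-! ### Conjugacy and the Abelianisation -/

lemma AreConjSubgroups.map_abelianization_eq {G : Type*} [Group G] {H K : Subgroup G}
    (h : AreConjSubgroups H K) : H.map Abelianization.of = K.map Abelianization.of := by
  obtain ⟨g, rfl⟩ := h
  rw [Subgroup.map_map]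
  congr 1
  ext y
  simp

lemma map_eq_of_map_abelianization_eq {G A : Type*} [Group G] [CommGroup A] {H K : Subgroup G}
    (h : H.map Abelianization.of = K.map Abelianization.of) (φ : G →* A) : H.map φ = K.map φ := by
  have hφ : φ = (Abelianization.lift φ).comp Abelianization.of := by ext; simp
  rw [hφ, ← Subgroup.map_map, h, Subgroup.map_map]

lemma even_iff_even_of_closure_pow_eq {A : Type*} [Group A] {g : A} (hg : g ^ 2 = 1)
    (hg1 : g ≠ 1) {u v : ℕ} (h : Subgroup.closure {g ^ u} = Subgroup.closure {g ^ v}) :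
    Even u ↔ Even v := by
  have key (w : ℕ) : Even w ↔ Subgroup.closure {g ^ w} = ⊥ := by
    rw [Subgroup.closure_eq_bot_iff, Set.singleton_subset_iff, Set.mem_singleton_iff,
      ← orderOf_dvd_iff_pow_eq_one, orderOf_eq_prime hg hg1, even_iff_two_dvd]
  rw [key, key, h]

open SphereBraidGroup in
/-- Under the exponent sum, `x` goes to the element `n - 1` of order two, so that for `j ≥ 1` the
generator `x ^ (2 ^ j * q)` becomes trivial, and `x ^ (i * q) * Δ` is detected by the parity of `i`. -/
lemma even_sub_of_map_abelianization_eq {n : ℕ} (hn : 4 ≤ n) (hn_even : Even n)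
    {x : SphereBraidGroup n}
    (hx : x = alpha0 n ∨ x = alpha0 n * alpha2 n * (alpha0 n)⁻¹) {j q i i' : ℕ} (hq : Odd q)
    (hi : i < 2 ^ j) (hi' : i' < 2 ^ j)
    (h : (dicyclicSubgroup x j q i).map Abelianization.of =
      (dicyclicSubgroup x j q i').map Abelianization.of) : Even ((i : ℤ) - i') := by
  rcases j with _ | j
  · obtain ⟨rfl, rfl⟩ : i = 0 ∧ i' = 0 := by omega
    simp
  obtain ⟨φ, hφ⟩ := exists_exponentHom (show 2 ≤ n by omega)
  set a := (Multiplicative.ofAdd 1 : Multiplicative (ZMod (2 * (n - 1)))) with ha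
  have h0 : φ (alpha0 n) = a ^ (n - 1) := by
    rw [alpha0, map_ascending hφ le_rfl, ascProd_const]
  have h2 : φ (alpha2 n) = a ^ (n - 1) := by
    have h1 := hφ (n - 3) (by omega)
    rw [show n - 3 + 1 = n - 2 by omega] at h1
    rw [alpha2, map_mul, map_ascending hφ (by omega), ascProd_const, map_pow, h1, ← pow_add]
    congr 1
    omega
  have hxa : φ x = a ^ (n - 1) := by
    rcases hx with rfl | rfl
    · exact h0
    · rw [map_mul, map_mul, map_inv, h0, h2, mul_inv_cancel_right]
  have hord : orderOf a = 2 * (n - 1) := by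
    rw [ha, orderOf_ofAdd_eq_addOrderOf, ZMod.addOrderOf_one]
  have hg : (a ^ (n - 1)) ^ 2 = 1 := by
    rw [← pow_mul, ← orderOf_dvd_iff_pow_eq_one, hord]
    exact ⟨1, by ring⟩
  have hg1 : a ^ (n - 1) ≠ 1 := fun h1 => by
    have := Nat.le_of_dvd (by omega) (orderOf_dvd_of_pow_eq_one h1)
    omega
  have himg (i : ℕ) : (dicyclicSubgroup x (j + 1) q i).map φ =
      Subgroup.closure {(a ^ (n - 1)) ^ (i * q + n / 2)} := by
    rw [dicyclicSubgroup, MonoidHom.map_closure, Set.image_pair, map_mul, map_pow, map_pow, hxa,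
      map_garside φ (by omega) hn_even hφ, ← pow_add, pow_succ', mul_assoc, pow_mul _ 2, hg, one_pow,
      Subgroup.closure_insert_one]
  have h3 := map_eq_of_map_abelianization_eq h φ
  rw [himg, himg] at h3
  have h4 := even_iff_even_of_closure_pow_eq hg hg1 h3
  have hq' : ¬ Even q := Nat.not_even_iff_odd.2 hq
  rw [Nat.even_add, Nat.even_add, Nat.even_mul, Nat.even_mul] at h4
  rw [Int.even_sub, Int.even_coe_nat, Int.even_coe_nat]
  tauto

open SphereBraidGroup in
lemma areConjSubgroups_dicyclicSubgroup {n : ℕ} {x : SphereBraidGroup n}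
    (hxD : garside n * x * (garside n)⁻¹ = x⁻¹) (j q : ℕ) {i i' : ℕ}
    (h : Even ((i : ℤ) - i')) :
    AreConjSubgroups (dicyclicSubgroup x j q i) (dicyclicSubgroup x j q i') := by
  obtain ⟨t, ht⟩ := h
  refine ⟨x ^ (-(t * q)), ?_⟩
  rw [dicyclicSubgroup, MonoidHom.map_closure, Set.image_pair]
  simp only [MulEquiv.toMonoidHom_eq_coe, MonoidHom.coe_coe, MulAut.conj_apply]
  rw [zpow_conj_pow_mul hxD (e' := i' * q) (by push_cast; linear_combination (q : ℤ) * ht)]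
  have hc : Commute (x ^ (-(t * q : ℤ))) (x ^ (2 ^ j * q)) :=
    ((Commute.refl x).zpow_left _).pow_right _
  rw [hc.eq, mul_inv_cancel_right, dicyclicSubgroup]

theorem mainTheorem3 (n : ℕ) (hn : 4 ≤ n) (hn_even : Even n)
    (N : ℕ) (x : SphereBraidGroup n)
    (hNx : (N = n ∧ x = SphereBraidGroup.alpha0 n) ∨
      (N = n - 2 ∧ x = SphereBraidGroup.alpha0 n * SphereBraidGroup.alpha2 n *
        (SphereBraidGroup.alpha0 n)⁻¹))
    (l k : ℕ) (hN : N = 2 ^ l * k) (hk : Odd k)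
    (j : ℕ) (hj : j ≤ l) (q : ℕ) (hq : q ∣ k) :
    (∀ i : ℕ, i < 2 ^ j →
      Nonempty (SphereBraidGroup.dicyclicSubgroup x j q i ≃*
        QuaternionGroup (2 ^ (l - j) * (k / q)))) ∧
    (∀ i i' : ℕ, i < 2 ^ j → i' < 2 ^ j →
      SphereBraidGroup.dicyclicSubgroup x j q i = SphereBraidGroup.dicyclicSubgroup x j q i' →
      i = i') ∧
    (∀ i i' : ℕ, i < 2 ^ j → i' < 2 ^ j →
      (AreConjSubgroups (SphereBraidGroup.dicyclicSubgroup x j q i)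
          (SphereBraidGroup.dicyclicSubgroup x j q i') ↔ Even ((i : ℤ) - (i' : ℤ))) ∧
      ((SphereBraidGroup.dicyclicSubgroup x j q i).map Abelianization.of =
          (SphereBraidGroup.dicyclicSubgroup x j q i').map Abelianization.of ↔
        Even ((i : ℤ) - (i' : ℤ)))) := by
  have hN2 : 2 ≤ N := by omega
  have hD1 := SphereBraidGroup.garside_sq_ne_one (show 3 ≤ n by omega)
  obtain ⟨hxD, hpow, hdvd⟩ : SphereBraidGroup.garside n * x * (SphereBraidGroup.garside n)⁻¹ = x⁻¹ ∧
      x ^ N = SphereBraidGroup.garside n ^ 2 ∧ ∀ r : ℕ, x ^ r = 1 → N ∣ r := by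
    rcases hNx with ⟨rfl, rfl⟩ | ⟨rfl, rfl⟩
    · exact ⟨SphereBraidGroup.garside_mul_alpha0 (by omega), SphereBraidGroup.alpha0_pow (by omega),
        fun r => SphereBraidGroup.dvd_of_alpha0_pow_eq_one (by omega)⟩
    · refine ⟨SphereBraidGroup.garside_mul_conj_alpha2 (by omega), ?_, fun r hr => ?_⟩
      · -- The full twist commutes with `α₀`, of which it is a power.
        rw [conj_pow, SphereBraidGroup.alpha2_pow (by omega),
          ← SphereBraidGroup.alpha0_pow (by omega), (Commute.self_pow _ n).eq, mul_inv_cancel_right]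
      · rw [conj_pow, conj_eq_one_iff] at hr
        exact SphereBraidGroup.dvd_of_alpha2_pow_eq_one (by omega) hr
  have hord : orderOf x = 2 * N :=
    orderOf_eq_two_mul_of_conj_eq_inv (by omega) hdvd hpow hD1 hxD
  have hqk : Odd q := hk.of_dvd_nat hq
  have hdm : N = 2 ^ j * q * (2 ^ (l - j) * (k / q)) := by
    rw [mul_mul_mul_comm, ← pow_add, Nat.add_sub_cancel' hj, Nat.mul_div_cancel' hq, hN]
  refine ⟨fun i _ => nonempty_closure_pow_mulEquiv_quaternionGroup hN2 hord hpow hxD hdm _,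
    fun i i' hi hi' h => ?_, fun i i' hi hi' => ?_⟩
  · have hmem : x ^ (i * q) * SphereBraidGroup.garside n ∈
        SphereBraidGroup.dicyclicSubgroup x j q i' := h ▸ Subgroup.subset_closure (by simp)
    have h1 := dvd_sub_of_mem_closure_pow hN2 hord hpow hxD hdm hmem
    have hq0 : (q : ℤ) ≠ 0 := by exact_mod_cast hqk.pos.ne'
    push_cast at h1
    rw [← sub_mul] at h1
    have h2 := Int.eq_zero_of_abs_lt_dvd ((mul_dvd_mul_iff_right hq0).1 h1)
      (by rw [abs_lt]; constructor <;> zify at hi hi' <;> linarith)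
    omega
  · have h1 := areConjSubgroups_dicyclicSubgroup hxD j q (i := i) (i' := i')
    have h2 := even_sub_of_map_abelianization_eq hn hn_even (hNx.imp And.right And.right)
      (j := j) hqk hi hi'
    exact ⟨⟨fun h => h2 h.map_abelianization_eq, h1⟩, ⟨h2, fun h => (h1 h).map_abelianization_eq⟩⟩
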